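/- Let $E$ be a sequentially complete Hausdorff locally convex topological vector space over $\mathbb{R}$ or $\mathbb{C}$. A family $\{f_\theta\}$ of linear maps $E\to E$ is called equicontinuous if for every continuous seminorm $p$ on $E$ there is a continuous seminorm $q$ on $E$ with $p(f_\theta(x))\le q(x)$ for all $\theta$ and all $x\in E$. Let $A_0,A_1$ be densely defined linear operators in $E$ such that for each $i\in\{0,1\}$ there is $\lambda_0\in\mathbb{R}$ (possibly depending on $i$) for which the resolvent $R_i(\lambda)=(\lambda\mathbf{1}-A_i)^{-1}$ is defined on the whole of $E$ for every real $\lambda\ge\lambda_0+1$, and the family $\{((\lambda-\lambda_0)R_i(\lambda))^m:\lambda\ge\lambda_0+1,\ m\in\mathbb{N}\}$ is equicontinuous. Suppose that $A_0$ and $A_1$ have the same domain and that $A_1-A_0$ is the restriction to this domain of a continuous linear operator $D:E\to E$. Then each $A_i$ is the generator of a unique strongly continuous semigroup $\Omega_i=(\Omega_i(t))_{t\ge0}$ of continuous linear operators on $E$, and for every $t\ge0$ $$\Omega_1(t)=\Omega_0(t)+\int_0^t\Omega_0(t-\tau)D\,\Omega_1(\tau)\,\mathrm{d}\tau,$$ $$\Omega_1(t)=\Omega_0(t)+\int_0^t\Omega_1(t-\tau)D\,\Omega_0(\tau)\,\mathrm{d}\tau,$$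 where the integrals exist in the strong sense: for every $x\in E$ the integrals of the $E$-valued functions $\tau\mapsto\Omega_0(t-\tau)D\,\Omega_1(\tau)x$ and $\tau\mapsto\Omega_1(t-\tau)D\,\Omega_0(\tau)x$ over $[0,t]$ exist as Riemann integrals. -/

import Mathlib

open Filter Topology
open scoped NNReal

namespace Perturbation

variable {𝕜 E : Type*} [RCLike 𝕜] [AddCommGroup E] [Module 𝕜 E]

/-- Sequential completeness: every Cauchy sequence converges. -/
def SeqComplete (E : Type*) [UniformSpace E] : Prop :=
  ∀ u : ℕ → E, CauchySeq u → ∃ x, Tendsto u atTop (𝓝 x)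

/-- `R` is the resolvent `(μ - A)⁻¹`, defined on the whole of `E`: for all `x` and `y`,
`R y = x` exactly when `x` is in the domain of `A` and `μ x - A x = y`. -/
def IsResolvent (A : E →ₗ.[𝕜] E) (μ : 𝕜) (R : E →ₗ[𝕜] E) : Prop :=
  ∀ x y : E, R y = x ↔ ∃ h : x ∈ A.domain, μ • x - A ⟨x, h⟩ = y

/-- A family of linear maps is equicontinuous: for every continuous seminorm `p` there is a
continuous seminorm `q` with `p (f θ x) ≤ q x` for all `θ` and `x`. -/
def EquicontinuousFamily [TopologicalSpace E] {Θ : Type*} (f : Θ → E →ₗ[𝕜] E) : Prop :=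
  ∀ p : Seminorm 𝕜 E, Continuous p →
    ∃ q : Seminorm 𝕜 E, Continuous q ∧ ∀ θ x, p (f θ x) ≤ q x

/-- The Hille–Yosida condition: `A` is densely defined and there is a real `lam₀` such that the
resolvent `R(lam₀ + lam) = (lam₀ + lam - A)⁻¹` is defined on the whole of `E` for all real
`lam ≥ 1`, and the family of all `(lam R(lam₀ + lam))ᵐ`, `lam ≥ 1`, `m ∈ ℕ`, is equicontinuous. -/
def HilleYosidaCondition [TopologicalSpace E] (A : E →ₗ.[𝕜] E) : Prop :=
  Dense (A.domain : Set E) ∧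
  ∃ (lam₀ : ℝ) (R : ℝ → E →ₗ[𝕜] E),
    (∀ lam : ℝ, 1 ≤ lam → IsResolvent A ((lam₀ + lam : ℝ) : 𝕜) (R (lam₀ + lam))) ∧
    EquicontinuousFamily (fun θ : {lam : ℝ // 1 ≤ lam} × ℕ =>
      (((θ.1 : ℝ) : 𝕜) • R (lam₀ + θ.1)) ^ θ.2)

/-- A strongly continuous one-parameter semigroup of continuous linear operators. -/
structure IsC0Semigroup [TopologicalSpace E] (Ω : ℝ≥0 → E →L[𝕜] E) : Prop where
  zero : Ω 0 = ContinuousLinearMap.id 𝕜 E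
  add : ∀ s t, Ω (s + t) = (Ω s).comp (Ω t)
  strongly_continuous : ∀ x, Continuous fun t => Ω t x

/-- `A` is the generator of `Ω`: `x` is in the domain of `A` and `A x = y` exactly when
`(Ω h x - x) / h → y` as `h → 0+`. -/
def IsGenerator [TopologicalSpace E] (A : E →ₗ.[𝕜] E) (Ω : ℝ≥0 → E →L[𝕜] E) : Prop :=
  ∀ x y : E, (∃ h : x ∈ A.domain, A ⟨x, h⟩ = y) ↔
    Tendsto (fun h : ℝ≥0 => (((h : ℝ)⁻¹ : ℝ) : 𝕜) • (Ω h x - x)) (𝓝[>] 0) (𝓝 y)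

/-- `Ω` is a strongly continuous semigroup whose generator is `A`. -/
def Generates [TopologicalSpace E] (A : E →ₗ.[𝕜] E) (Ω : ℝ≥0 → E →L[𝕜] E) : Prop :=
  IsC0Semigroup Ω ∧ IsGenerator A Ω

variable (𝕜) in
/-- `I` is the Riemann integral of `f : ℝ → E` over `[a, b]`, `a ≤ b`: the Riemann sums over
tagged partitions `a = s 0 ≤ ξ 0 ≤ s 1 ≤ … ≤ s n = b` tend to `I` as the mesh tends to `0`. -/
def HasRiemannIntegral [TopologicalSpace E] (f : ℝ → E) (a b : ℝ) (I : E) : Prop :=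
  ∀ U ∈ 𝓝 I, ∃ δ : ℝ, 0 < δ ∧ ∀ (n : ℕ) (s ξ : ℕ → ℝ), s 0 = a → s n = b →
    (∀ k < n, s k ≤ ξ k ∧ ξ k ≤ s (k + 1) ∧ s (k + 1) - s k < δ) →
    ∑ k ∈ Finset.range n, ((s (k + 1) - s k : ℝ) : 𝕜) • f (ξ k) ∈ U

/-- `J` is the strong Riemann integral of the operator-valued function `F` over `[a, b]`:
`J x = ∫ F(τ) x dτ` for every `x`. -/
def HasStrongIntegral [TopologicalSpace E] (F : ℝ → E →L[𝕜] E) (a b : ℝ) (J : E →L[𝕜] E) : Prop :=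
  ∀ x, HasRiemannIntegral 𝕜 (fun τ => F τ x) a b (J x)

end Perturbation

/-! Existence of the semigroups. Put `B = A - c`, with `c` the real shift in the Hille–Yosida
condition. For `λ = 2ᵏ` the operator `J k = λ R(c + λ) = (1 - 2⁻ᵏ B)⁻¹` is a backward Euler step for
`u' = B u`, and all powers of these steps are equicontinuous. On the domain of `B²` the identity
`J(k+1)² - J k = -4⁻⁽ᵏ⁺¹⁾ J(k+1)² J k B²` (`sq_sub`) shows that halving the step changes the
approximation at time `t` by `O(2⁻ᵏ)` (`floor_succ_sub_le`), which is summable. Density of that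
domain, equicontinuity and sequential completeness give `T t x = lim (J k)^⌊t 2ᵏ⌋ x` for every `x`
(`exists_tendsto`). `T` is generated by `B` (`generates_limit`), so `eᶜᵗ T(t)` is generated by `A`.

Uniqueness and the integral formulas. If `T`, `S` have generators `A`, `A'` with common domain and
`A' - A = D` there, then for `x` in the domain `τ ↦ T(t - τ) S(τ) x` has right derivative `T(t - τ)
D S(τ) x` (`Generates.hasRightDeriv`) and runs from `T(t) x` to `S(t) x`. A mean value inequality
for right derivatives, one seminorm at a time, replaces integration theory. With `D = 0` it gives
uniqueness; in general it compares Riemann sums directly with `S(t) x - T(t) x`, and density extends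
this to all `x`. Exchanging the semigroups and replacing `D` by `-D` gives the second formula. -/

namespace Perturbation

/-! ### Convergence, continuity and Cauchy sequences through continuous seminorms. -/

section SeminormTopology

variable {𝕜 E : Type*} [RCLike 𝕜] [AddCommGroup E] [Module 𝕜 E]

theorem norm_ofReal_of_nonneg {c : ℝ} (hc : 0 ≤ c) : ‖(c : 𝕜)‖ = c := by
  rw [RCLike.norm_ofReal, abs_of_nonneg hc]

theorem seminorm_smul_ofReal (p : Seminorm 𝕜 E) {c : ℝ} (hc : 0 ≤ c) (x : E) :
    p ((c : 𝕜) • x) = c * p x := by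
  rw [map_smul_eq_mul, norm_ofReal_of_nonneg hc]

section Topological

variable [TopologicalSpace E]

theorem seminorm_tendsto {ι : Type*} {l : Filter ι} {u : ι → E} {a : E} {p : Seminorm 𝕜 E}
    (hp : Continuous p) (h : Tendsto u l (𝓝 a)) : Tendsto (fun i => p (u i)) l (𝓝 (p a)) :=
  (hp.tendsto a).comp h

theorem exists_seminorm_comp_le (D : E →L[𝕜] E) (p : Seminorm 𝕜 E) (hp : Continuous p) :
    ∃ q : Seminorm 𝕜 E, Continuous q ∧ ∀ x, p (D x) ≤ q x :=
  ⟨p.comp (D : E →ₗ[𝕜] E), hp.comp D.continuous, fun _ => le_rfl⟩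

/-- A single continuous seminorm dominating `p` and the whole family. -/
theorem EquicontinuousFamily.exists_seminorm_ge {Θ : Type*} {f : Θ → E →ₗ[𝕜] E}
    (hf : EquicontinuousFamily f) (p : Seminorm 𝕜 E) (hp : Continuous p) :
    ∃ q : Seminorm 𝕜 E, Continuous q ∧ (∀ x, p x ≤ q x) ∧ ∀ θ x, p (f θ x) ≤ q x := by
  obtain ⟨q, hq, h⟩ := hf p hp
  refine ⟨p ⊔ q, ?_, fun x => le_sup_left (a := p x), fun θ x => (h θ x).trans
    (le_sup_right (b := q x))⟩
  exact hp.sup hq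

variable [PolynormableSpace 𝕜 E]

variable (𝕜) in
theorem tendsto_nhds_iff_seminorm {ι : Type*} {l : Filter ι} {u : ι → E} {a : E} :
    Tendsto u l (𝓝 a) ↔
      ∀ p : Seminorm 𝕜 E, Continuous p → ∀ ε > 0, ∀ᶠ i in l, p (u i - a) < ε := by
  rw [(PolynormableSpace.withSeminorms 𝕜 E).tendsto_nhds]
  exact ⟨fun h p hp => h ⟨p, hp⟩, fun h p => h p.1 p.2⟩

variable (𝕜) in
theorem mem_nhds_iff_seminorm {a : E} {U : Set E} :
    U ∈ 𝓝 a ↔ ∃ p : Seminorm 𝕜 E, Continuous p ∧ ∃ ε > 0, ∀ x, p (x - a) < ε → x ∈ U := by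
  constructor
  · intro hU
    obtain ⟨s, r, hr, h⟩ :=
      ((PolynormableSpace.withSeminorms 𝕜 E).mem_nhds_iff a U).1 hU
    refine ⟨s.sup fun q : {q : Seminorm 𝕜 E // Continuous q} => (q : Seminorm 𝕜 E), ?_, r, hr,
      fun x hx => h hx⟩
    refine Finset.sup_induction (p := fun q : Seminorm 𝕜 E => Continuous q) continuous_const
      (fun q₁ h₁ q₂ h₂ => h₁.sup h₂) fun i _ => i.2
  · rintro ⟨p, hp, ε, hε, h⟩
    have := (tendsto_nhds_iff_seminorm 𝕜 (l := 𝓝 a) (u := id) (a := a)).1 tendsto_id p hp ε hε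
    exact mem_of_superset this h

variable (𝕜) in
theorem eq_of_forall_seminorm_sub_le [T2Space E] {x y : E}
    (h : ∀ p : Seminorm 𝕜 E, Continuous p → p (x - y) ≤ 0) : x = y := by
  have : Tendsto (fun _ : ℕ => x) atTop (𝓝 y) :=
    (tendsto_nhds_iff_seminorm 𝕜).2 fun p hp ε hε => Eventually.of_forall fun _ =>
      (h p hp).trans_lt hε
  exact tendsto_nhds_unique tendsto_const_nhds this

variable (𝕜) in
theorem exists_seminorm_sub_lt_of_dense {s : Set E} (hs : Dense s) (x : E) {p : Seminorm 𝕜 E}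
    (hp : Continuous p) {ε : ℝ} (hε : 0 < ε) : ∃ y ∈ s, p (x - y) < ε := by
  have hU : {y | p (y - x) < ε} ∈ 𝓝 x := (mem_nhds_iff_seminorm 𝕜).2 ⟨p, hp, ε, hε, fun _ h => h⟩
  obtain ⟨y, hy, hys⟩ := hs.inter_nhds_nonempty hU
  exact ⟨y, hy, by rw [map_sub_rev]; exact hys⟩

theorem continuous_of_seminorm_le (f : E →ₗ[𝕜] E)
    (h : ∀ p : Seminorm 𝕜 E, Continuous p → ∃ q : Seminorm 𝕜 E, Continuous q ∧
      ∀ x, p (f x) ≤ q x) : Continuous f := by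
  rw [continuous_iff_continuousAt]
  intro a
  refine (tendsto_nhds_iff_seminorm 𝕜).2 fun p hp ε hε => ?_
  obtain ⟨q, hq, hpq⟩ := h p hp
  filter_upwards [(tendsto_nhds_iff_seminorm 𝕜).1 (tendsto_id (x := 𝓝 a)) q hq ε hε] with x hx
  rw [← map_sub]
  exact (hpq _).trans_lt hx

end Topological

section Uniform

variable [UniformSpace E] [IsUniformAddGroup E] [PolynormableSpace 𝕜 E]

variable (𝕜) in
theorem cauchySeq_of_seminorm {u : ℕ → E}
    (h : ∀ p : Seminorm 𝕜 E, Continuous p → ∀ ε > 0, ∃ N, ∀ m ≥ N, ∀ n ≥ N,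
      p (u m - u n) < ε) : CauchySeq u := by
  rw [cauchySeq_iff]
  intro V hV
  rw [uniformity_eq_comap_nhds_zero] at hV
  obtain ⟨U, hU, hUV⟩ := hV
  obtain ⟨p, hp, ε, hε, hpU⟩ := (mem_nhds_iff_seminorm 𝕜).1 hU
  obtain ⟨N, hN⟩ := h p hp ε hε
  refine ⟨N, fun m hm n hn => hUV (hpU _ ?_)⟩
  simpa using hN n hn m hm

variable (𝕜) in
/-- A continuous function on a compact interval is uniformly continuous for every continuous
seminorm. -/
theorem exists_seminorm_sub_lt_of_continuous {f : ℝ → E} (hf : Continuous f) (a b : ℝ)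
    {p : Seminorm 𝕜 E} (hp : Continuous p) {ε : ℝ} (hε : 0 < ε) :
    ∃ δ > 0, ∀ x ∈ Set.Icc a b, ∀ y ∈ Set.Icc a b, |x - y| < δ → p (f x - f y) < ε := by
  have huc := isCompact_Icc.uniformContinuousOn_of_continuous (s := Set.Icc a b) hf.continuousOn
  have hV : {z : E × E | p (z.2 - z.1) < ε} ∈ uniformity E := by
    rw [uniformity_eq_comap_nhds_zero]
    exact ⟨{z | p z < ε}, (mem_nhds_iff_seminorm 𝕜).2 ⟨p, hp, ε, hε, by simp⟩, fun _ h => h⟩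
  have := huc hV
  rw [mem_map, Metric.uniformity_basis_dist.inf_principal _ |>.mem_iff] at this
  obtain ⟨δ, hδ, h⟩ := this
  refine ⟨δ, hδ, fun x hx y hy hxy => ?_⟩
  have := @h (y, x) ⟨by simpa [Real.dist_eq, abs_sub_comm] using hxy, hy, hx⟩
  exact this

end Uniform

end SeminormTopology

/-! ### Right derivatives, the mean value inequality and Riemann sums. -/

section RightDerivative

variable {𝕜 E : Type*} [RCLike 𝕜] [AddCommGroup E] [Module 𝕜 E]

variable (𝕜) in
/-- `y` is the right derivative of `F` at `s`. -/
def HasRightDeriv [TopologicalSpace E] (F : ℝ≥0 → E) (y : E) (s : ℝ≥0) : Prop :=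
  Tendsto (fun h : ℝ≥0 => (((h : ℝ)⁻¹ : ℝ) : 𝕜) • (F (s + h) - F s)) (𝓝[>] 0) (𝓝 y)

theorem tendsto_toNNReal_sub_nhdsGT (x : ℝ) :
    Tendsto (fun z : ℝ => (z - x).toNNReal) (𝓝[>] x) (𝓝[>] 0) := by
  refine tendsto_nhdsWithin_iff.2 ⟨?_, ?_⟩
  · have : Continuous fun z : ℝ => (z - x).toNNReal := by fun_prop
    have := (this.tendsto x).mono_left (nhdsWithin_le_nhds (s := Set.Ioi x))
    simpa using this
  · filter_upwards [self_mem_nhdsWithin] with z hz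
    simpa using hz

/-- Mean value inequality for right derivatives, with respect to a seminorm. -/
theorem seminorm_sub_sub_smul_le [TopologicalSpace E] [IsTopologicalAddGroup E]
    [ContinuousSMul 𝕜 E] {F f : ℝ≥0 → E} {a b : ℝ≥0} (hab : a ≤ b) (hF : Continuous F)
    (hf : ∀ s, a ≤ s → s < b → HasRightDeriv 𝕜 F (f s) s) {p : Seminorm 𝕜 E} (hp : Continuous p)
    {v : E} {C : ℝ} (hC : ∀ s, a ≤ s → s < b → p (f s - v) ≤ C) :
    p (F b - F a - ((b - a : ℝ) : 𝕜) • v) ≤ C * (b - a) := by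
  set g : ℝ → ℝ := fun s => p (F s.toNNReal - F a - ((s - a : ℝ) : 𝕜) • v) with hg
  have hgc : Continuous g := by
    have : Continuous fun s : ℝ => ((s - a : ℝ) : 𝕜) := RCLike.continuous_ofReal.comp (by fun_prop)
    have h2 : Continuous fun s : ℝ => F s.toNNReal := hF.comp continuous_real_toNNReal
    exact hp.comp (by fun_prop)
  -- `g` is real-valued with upper right slope at most `C`, so the scalar comparison theorem applies
  -- with boundary `C * (s - a)`.
  have key := image_le_of_liminf_slope_right_le_deriv_boundary (f := g) (a := a) (b := b)
    (B := fun s => C * (s - a)) (B' := fun _ => C) hgc.continuousOn (by simp [hg])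
    (by fun_prop)
    (fun x _ => by
      simpa using (((hasDerivAt_id x).sub_const (a : ℝ)).const_mul C).hasDerivWithinAt) ?_
    (x := (b : ℝ)) ⟨NNReal.coe_le_coe.2 hab, le_rfl⟩
  · simpa [hg] using key
  intro x hx r hr
  apply Eventually.frequently
  obtain ⟨x, rfl⟩ : ∃ y : ℝ≥0, (y : ℝ) = x := ⟨⟨x, a.2.trans hx.1⟩, rfl⟩
  have hax : a ≤ x := NNReal.coe_le_coe.1 hx.1
  have hxb : x < b := NNReal.coe_lt_coe.1 hx.2
  have hlim : Tendsto (fun h : ℝ≥0 => p ((((h : ℝ)⁻¹ : ℝ) : 𝕜) • (F (x + h) - F x) - v)) (𝓝[>] 0)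
      (𝓝 (p (f x - v))) :=
    seminorm_tendsto hp ((hf x hax hxb).sub tendsto_const_nhds)
  have hev := (tendsto_toNNReal_sub_nhdsGT (x : ℝ)).eventually
    (hlim.eventually_lt_const ((hC x hax hxb).trans_lt hr))
  filter_upwards [hev, self_mem_nhdsWithin] with z hz hxz
  have hxz' : (x : ℝ) < z := hxz
  have hpos : 0 < z - x := sub_pos.2 hxz'
  rw [slope_def_field, div_lt_iff₀ hpos]
  have hcoe : ((z - x).toNNReal : ℝ) = z - x := Real.coe_toNNReal _ hpos.le
  have hadd : x + (z - x).toNNReal = z.toNNReal := by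
    apply NNReal.eq
    rw [NNReal.coe_add, hcoe, Real.coe_toNNReal _ (x.2.trans hxz'.le)]
    ring
  rw [hadd, hcoe] at hz
  have hne : (((z - x : ℝ)) : 𝕜) ≠ 0 := RCLike.ofReal_ne_zero.2 hpos.ne'
  have hsplit : F z.toNNReal - F a - ((z - a : ℝ) : 𝕜) • v =
      (F (x : ℝ).toNNReal - F a - ((x - a : ℝ) : 𝕜) • v) +
      ((z - x : ℝ) : 𝕜) • ((((z - x : ℝ)⁻¹ : ℝ) : 𝕜) • (F z.toNNReal - F x) - v) := by
    rw [smul_sub, smul_smul, RCLike.ofReal_inv, mul_inv_cancel₀ hne, Real.toNNReal_coe]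
    push_cast
    module
  have : g z ≤ g x + (z - x) * p ((((z - x : ℝ)⁻¹ : ℝ) : 𝕜) • (F z.toNNReal - F x) - v) := by
    simp only [hg]
    rw [hsplit, ← seminorm_smul_ofReal p hpos.le]
    exact map_add_le_add p _ _
  nlinarith

theorem eq_of_hasRightDeriv_zero [TopologicalSpace E] [IsTopologicalAddGroup E]
    [ContinuousSMul 𝕜 E] [PolynormableSpace 𝕜 E] [T2Space E] {F : ℝ≥0 → E} {b : ℝ≥0}
    (hF : Continuous F) (hf : ∀ s < b, HasRightDeriv 𝕜 F 0 s) : F b = F 0 := by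
  refine eq_of_forall_seminorm_sub_le 𝕜 fun p hp => ?_
  have := seminorm_sub_sub_smul_le (𝕜 := 𝕜) (F := F) (f := fun _ => 0) (zero_le (a := b)) hF
    (fun s _ hs => hf s hs) hp (v := 0) (C := 0) (by simp)
  simpa using this

/-- The Riemann sums of a continuous right derivative `f` of `F` over fine tagged partitions of
`[0, b]` are close to `F b - F 0` in any given continuous seminorm. -/
theorem exists_riemann_sum_close [UniformSpace E] [IsUniformAddGroup E]
    [ContinuousSMul 𝕜 E] [PolynormableSpace 𝕜 E] {F f : ℝ≥0 → E} {b : ℝ≥0} (hF : Continuous F)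
    (hfc : Continuous f) (hf : ∀ s < b, HasRightDeriv 𝕜 F (f s) s) {p : Seminorm 𝕜 E}
    (hp : Continuous p) {ε : ℝ} (hε : 0 < ε) :
    ∃ δ : ℝ, 0 < δ ∧ ∀ (n : ℕ) (s ξ : ℕ → ℝ), s 0 = 0 → s n = b →
      (∀ k < n, s k ≤ ξ k ∧ ξ k ≤ s (k + 1) ∧ s (k + 1) - s k < δ) →
      p (∑ k ∈ Finset.range n, ((s (k + 1) - s k : ℝ) : 𝕜) • f (ξ k).toNNReal - (F b - F 0))
        ≤ ε * b := by
  obtain ⟨δ, hδ, hunif⟩ := exists_seminorm_sub_lt_of_continuous 𝕜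
    (hfc.comp continuous_real_toNNReal) 0 b hp hε
  refine ⟨δ, hδ, fun n s ξ h0 hn hs => ?_⟩
  have hmono : ∀ k ≤ n, 0 ≤ s k := by
    intro k hk
    induction k with
    | zero => exact h0.ge
    | succ k ih =>
      have := hs k hk
      linarith [ih (by omega)]
  have hmono' : ∀ k ≤ n, s k ≤ b := by
    intro k hk
    induction hk using Nat.decreasingInduction with
    | self => exact hn.le
    | of_succ k hk ih =>
      have := hs k hk
      linarith
  -- On each subinterval `f` stays within `ε` of its value at the tag, so the mean value inequality
  -- gives an error of `ε` times the length; these errors add up along the partition.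
  have hbound : ∀ m ≤ n, p (∑ k ∈ Finset.range m, ((s (k + 1) - s k : ℝ) : 𝕜) • f (ξ k).toNNReal
      - (F (s m).toNNReal - F 0)) ≤ ε * s m := by
    intro m hm
    induction m with
    | zero => simp [h0]
    | succ m ih =>
      obtain ⟨h1, h2, h3⟩ := hs m hm
      have hs0 := hmono m (by omega)
      have hs1 := hmono (m + 1) hm
      have hb1 := hmono' (m + 1) hm
      have hstep := seminorm_sub_sub_smul_le (𝕜 := 𝕜) (F := F) (f := f) (a := (s m).toNNReal)
        (b := (s (m + 1)).toNNReal) (Real.toNNReal_le_toNNReal (h1.trans h2)) hF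
        (fun u _ hu => hf u (hu.trans_le (Real.toNNReal_le_iff_le_coe.2 hb1)))
        hp (v := f (ξ m).toNNReal) (C := ε) (fun u hu1 hu2 => by
          have hu1' : s m ≤ u := Real.toNNReal_le_iff_le_coe.1 hu1
          have hu2' : (u : ℝ) < s (m + 1) := Real.lt_toNNReal_iff_coe_lt.1 hu2
          have := hunif u ⟨u.2, hu2'.le.trans hb1⟩ (ξ m) ⟨hs0.trans h1, h2.trans hb1⟩
            (by rw [abs_lt]; constructor <;> linarith)
          simpa using this.le)
      rw [Real.coe_toNNReal _ hs0, Real.coe_toNNReal _ hs1, map_sub_rev] at hstep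
      rw [Finset.sum_range_succ]
      have e : ∑ k ∈ Finset.range m, ((s (k + 1) - s k : ℝ) : 𝕜) • f (ξ k).toNNReal
          + ((s (m + 1) - s m : ℝ) : 𝕜) • f (ξ m).toNNReal - (F (s (m + 1)).toNNReal - F 0)
        = (∑ k ∈ Finset.range m, ((s (k + 1) - s k : ℝ) : 𝕜) • f (ξ k).toNNReal
            - (F (s m).toNNReal - F 0))
          + (((s (m + 1) - s m : ℝ) : 𝕜) • f (ξ m).toNNReal
            - (F (s (m + 1)).toNNReal - F (s m).toNNReal)) := by abel
      rw [e]
      refine (map_add_le_add p _ _).trans ?_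
      linarith [ih (by omega)]
  simpa [hn] using hbound n le_rfl

end RightDerivative

/-! ### Backward Euler steps and their convergence along dyadic step sizes. -/

section EulerScheme

variable {𝕜 E : Type*} [RCLike 𝕜] [AddCommGroup E] [Module 𝕜 E]

/-- `J k` is the backward Euler step `(1 - 2⁻ᵏ B)⁻¹` for the densely defined operator `B`, and the
powers of all these steps are equicontinuous. -/
structure IsEulerScheme [TopologicalSpace E] (B : E →ₗ.[𝕜] E) (J : ℕ → E →ₗ[𝕜] E) : Prop where
  dense : Dense (B.domain : Set E)
  apply_eq_iff : ∀ k x z, J k z = x ↔ (x, (2 : 𝕜) ^ k • (x - z)) ∈ B.graph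
  equicontinuous : EquicontinuousFamily fun θ : ℕ × ℕ => J θ.1 ^ θ.2

namespace IsEulerScheme

section Algebra

variable [TopologicalSpace E] {B : E →ₗ.[𝕜] E} {J : ℕ → E →ₗ[𝕜] E} (hJ : IsEulerScheme B J)
include hJ

theorem apply_mem (k : ℕ) (z : E) : (J k z, (2 : 𝕜) ^ k • (J k z - z)) ∈ B.graph :=
  (hJ.apply_eq_iff k _ z).1 rfl

theorem apply_sub {x y : E} (h : (x, y) ∈ B.graph) (k : ℕ) :
    J k (x - ((2 : 𝕜) ^ k)⁻¹ • y) = x := by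
  rw [hJ.apply_eq_iff, sub_sub_cancel, smul_inv_smul₀ (pow_ne_zero _ two_ne_zero)]
  exact h

theorem apply_eq_add {x y : E} (h : (x, y) ∈ B.graph) (k : ℕ) :
    J k x = x + ((2 : 𝕜) ^ k)⁻¹ • J k y := by
  have := hJ.apply_sub h k
  rw [map_sub, map_smul, sub_eq_iff_eq_add] at this
  exact this

theorem apply_mem_graph {x y : E} (h : (x, y) ∈ B.graph) (k : ℕ) : (J k x, J k y) ∈ B.graph := by
  have := hJ.apply_mem k x
  rwa [hJ.apply_eq_add h k, add_sub_cancel_left, smul_inv_smul₀ (pow_ne_zero _ two_ne_zero),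
    ← hJ.apply_eq_add h k] at this

theorem pow_apply_mem_graph {x y : E} (h : (x, y) ∈ B.graph) (k n : ℕ) :
    ((J k ^ n) x, (J k ^ n) y) ∈ B.graph := by
  induction n with
  | zero => simpa using h
  | succ n ih => simpa only [pow_succ', Module.End.mul_apply] using hJ.apply_mem_graph ih k

theorem commute (k l : ℕ) : Commute (J k) (J l) := by
  refine LinearMap.ext fun z => ?_
  rw [Module.End.mul_apply, Module.End.mul_apply, hJ.apply_eq_iff]
  have := hJ.apply_mem_graph (hJ.apply_mem k z) l
  rwa [map_smul, map_sub] at this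

/-- With `h = 2⁻⁽ᵏ⁺¹⁾`, the inverses of `J (k + 1) ^ 2` and `J k` are `(1 - hB)²` and `1 - 2hB`,
which differ only by `h²B²`. -/
theorem sq_sub {x y w : E} (hx : (x, y) ∈ B.graph) (hy : (y, w) ∈ B.graph) (k : ℕ) :
    (J (k + 1) ^ 2) x - J k x
      = -(((2 : 𝕜) ^ (k + 1))⁻¹ ^ 2 • (J (k + 1) ^ 2) (J k w)) := by
  have h0 := hJ.apply_eq_add hx k
  have h1 := hJ.apply_eq_add (hJ.apply_mem_graph hx k) (k + 1)
  have h2 := hJ.apply_eq_add (hJ.apply_mem_graph hy k) (k + 1)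
  have e : ((2 : 𝕜) ^ k)⁻¹ = 2 * ((2 : 𝕜) ^ (k + 1))⁻¹ := by
    rw [pow_succ]; field_simp
  rw [e] at h0
  set c := ((2 : 𝕜) ^ (k + 1))⁻¹
  have h3 := congrArg (J (k + 1)) h1
  have h4 := congrArg (J (k + 1)) h2
  have h5 := congrArg (fun u => J (k + 1) (J (k + 1) u)) h0
  simp only [map_add, map_smul] at h3 h4 h5
  simp only [pow_two, Module.End.mul_apply]
  have h5' : J (k + 1) (J (k + 1) x)
      = J (k + 1) (J (k + 1) (J k x)) - (2 * c) • J (k + 1) (J (k + 1) (J k y)) := by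
    rw [h5]; abel
  clear_value c
  rw [h5', h3, h1, h4]
  module

/-- One continuous seminorm `q` dominates `p`, all `p ∘ J k ^ n` and all `p ∘ J k ^ n ∘ J l ^ m`. -/
theorem exists_seminorm (p : Seminorm 𝕜 E) (hp : Continuous p) :
    ∃ q : Seminorm 𝕜 E, Continuous q ∧ (∀ x, p x ≤ q x) ∧ (∀ k n x, p ((J k ^ n) x) ≤ q x) ∧
      ∀ k n l m x, p ((J k ^ n) ((J l ^ m) x)) ≤ q x := by
  obtain ⟨q, hq, hpq, h⟩ := hJ.equicontinuous.exists_seminorm_ge p hp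
  obtain ⟨r, hr, hqr, h'⟩ := hJ.equicontinuous.exists_seminorm_ge q hq
  exact ⟨r, hr, fun x => (hpq x).trans (hqr x), fun k n x => (h (k, n) x).trans (hqr x),
    fun k n l m x => (h (k, n) _).trans (h' (l, m) x)⟩

end Algebra

section Estimates

theorem seminorm_smul_pow_apply_le {J : ℕ → E →ₗ[𝕜] E} {p q : Seminorm 𝕜 E}
    (hpq : ∀ k n x, p ((J k ^ n) x) ≤ q x) (k n l : ℕ) (y : E) :
    p (((2 : 𝕜) ^ l)⁻¹ • (J k ^ n) y) ≤ (2 ^ l)⁻¹ * q y := by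
  rw [map_smul_eq_mul, norm_inv, norm_pow, RCLike.norm_ofNat]
  exact mul_le_mul_of_nonneg_left (hpq k n y) (by positivity)

variable [TopologicalSpace E] {B : E →ₗ.[𝕜] E} {J : ℕ → E →ₗ[𝕜] E} (hJ : IsEulerScheme B J)
  {p q : Seminorm 𝕜 E} (hpq : ∀ k n x, p ((J k ^ n) x) ≤ q x)
include hJ hpq

/-- Each further step adds `2⁻ᵏ` times a power of `J k` applied to `y = Bx`, and these powers are
equicontinuous. -/
theorem pow_add_sub_pow_le {x y : E} (h : (x, y) ∈ B.graph) (k n d : ℕ) :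
    p ((J k ^ (n + d)) x - (J k ^ n) x) ≤ d * (2 ^ k)⁻¹ * q y := by
  induction d with
  | zero => simp
  | succ d ih =>
    have e : (J k ^ (n + (d + 1))) x = (J k ^ (n + d)) x
        + ((2 : 𝕜) ^ k)⁻¹ • (J k ^ (n + d + 1)) y := by
      rw [← add_assoc, pow_succ, Module.End.mul_apply, Module.End.mul_apply, hJ.apply_eq_add h,
        map_add, map_smul]
    rw [e, add_sub_right_comm]
    refine (map_add_le_add p _ _).trans ?_
    have := seminorm_smul_pow_apply_le hpq k (n + d + 1) k y
    push_cast
    linarith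

theorem pow_sub_pow_le {x y : E} (h : (x, y) ∈ B.graph) (k : ℕ) {m n : ℕ} (hmn : n ≤ m) :
    p ((J k ^ m) x - (J k ^ n) x) ≤ ((m : ℝ) - n) * (2 ^ k)⁻¹ * q y := by
  obtain ⟨d, rfl⟩ := Nat.exists_eq_add_of_le hmn
  have := hJ.pow_add_sub_pow_le hpq h k n d
  simpa using this

/-- Here `Jⁿx - x = 2⁻ᵏ ∑ Jᵐy` over `1 ≤ m ≤ n`, so the error is governed by `Jᵐy - y`. Since `y`
need not lie in the domain, it is compared with a point `z` that does. This first-order expansion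
later identifies the generator. -/
theorem pow_sub_sub_smul_le {x y z v : E} (hx : (x, y) ∈ B.graph) (hz : (z, v) ∈ B.graph)
    (k n : ℕ) : p ((J k ^ n) x - x - ((n : 𝕜) * ((2 : 𝕜) ^ k)⁻¹) • y)
      ≤ n * (2 ^ k)⁻¹ * (q (y - z) + p (y - z) + n * (2 ^ k)⁻¹ * q v) := by
  have hM : ∀ m ≤ n, p ((J k ^ m) y - y) ≤ q (y - z) + p (y - z) + n * (2 ^ k)⁻¹ * q v := by
    intro m hm
    have h1 := hJ.pow_sub_pow_le hpq hz k (Nat.zero_le m)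
    have e : (J k ^ m) y - y = (J k ^ m) (y - z) + (-(y - z)) + ((J k ^ m) z - (J k ^ 0) z) := by
      simp only [map_sub, pow_zero, Module.End.one_apply]; abel
    have h2 : ((m : ℝ) - (0 : ℕ)) * (2 ^ k)⁻¹ * q v ≤ n * (2 ^ k)⁻¹ * q v := by
      have : (m : ℝ) ≤ n := by exact_mod_cast hm
      have hq : 0 ≤ q v := apply_nonneg q v
      simp only [Nat.cast_zero, sub_zero]
      gcongr
    rw [e]
    calc _ ≤ p ((J k ^ m) (y - z)) + p (-(y - z)) + p ((J k ^ m) z - (J k ^ 0) z) :=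
          (map_add_le_add p _ _).trans (by gcongr; exact map_add_le_add p _ _)
      _ ≤ _ := by
          rw [map_neg_eq_map]
          have := hpq k m (y - z)
          linarith
  set M := q (y - z) + p (y - z) + n * (2 ^ k)⁻¹ * q v
  have key : ∀ m ≤ n, p ((J k ^ m) x - x - ((m : 𝕜) * ((2 : 𝕜) ^ k)⁻¹) • y)
      ≤ m * (2 ^ k)⁻¹ * M := by
    intro m hm
    induction m with
    | zero => simp
    | succ m ih =>
      have e : (J k ^ (m + 1)) x = (J k ^ m) x + ((2 : 𝕜) ^ k)⁻¹ • (J k ^ (m + 1)) y := by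
        rw [pow_succ, Module.End.mul_apply, Module.End.mul_apply, hJ.apply_eq_add hx,
          map_add, map_smul]
      have e2 : (J k ^ (m + 1)) x - x - (((m + 1 : ℕ) : 𝕜) * ((2 : 𝕜) ^ k)⁻¹) • y
          = ((J k ^ m) x - x - ((m : 𝕜) * ((2 : 𝕜) ^ k)⁻¹) • y)
            + ((2 : 𝕜) ^ k)⁻¹ • ((J k ^ (m + 1)) y - y) := by
        rw [e]; push_cast; module
      rw [e2]
      refine (map_add_le_add p _ _).trans ?_
      rw [map_smul_eq_mul p, norm_inv, norm_pow, RCLike.norm_ofNat]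
      have := mul_le_mul_of_nonneg_left (hM (m + 1) hm) (by positivity : (0 : ℝ) ≤ (2 ^ k)⁻¹)
      push_cast
      linarith [ih (by omega)]
  exact key n le_rfl

end Estimates

section Cauchy

variable [TopologicalSpace E] {B : E →ₗ.[𝕜] E} {J : ℕ → E →ₗ[𝕜] E} (hJ : IsEulerScheme B J)
  {p q : Seminorm 𝕜 E} (hpq : ∀ k n x, p ((J k ^ n) x) ≤ q x)
  (hpq' : ∀ k n l m x, p ((J k ^ n) ((J l ^ m) x)) ≤ q x)
include hJ hpq'

theorem pow_two_mul_sub_pow_le {x y w : E} (hx : (x, y) ∈ B.graph) (hy : (y, w) ∈ B.graph)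
    (k n : ℕ) :
    p ((J (k + 1) ^ (2 * n)) x - (J k ^ n) x) ≤ n * ((2 ^ (k + 1))⁻¹ ^ 2 * q w) := by
  -- Telescoping replaces two fine steps by one coarse step at a time. The coarse steps already
  -- taken accumulate on the starting point, so the induction must allow any `(J k ^ j) x`.
  suffices h : ∀ j, p ((J (k + 1) ^ (2 * n)) ((J k ^ j) x) - (J k ^ n) ((J k ^ j) x))
      ≤ n * ((2 ^ (k + 1))⁻¹ ^ 2 * q w) by simpa using h 0
  induction n with
  | zero => simp
  | succ n ih =>
    intro j
    have hs := hJ.sq_sub (hJ.pow_apply_mem_graph hx k j) (hJ.pow_apply_mem_graph hy k j) k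
    rw [← Module.End.mul_apply (J k), ← Module.End.mul_apply (J k), ← pow_succ',
      sub_eq_iff_eq_add] at hs
    have e : (J (k + 1) ^ (2 * (n + 1))) ((J k ^ j) x) - (J k ^ (n + 1)) ((J k ^ j) x)
        = -(((2 : 𝕜) ^ (k + 1))⁻¹ ^ 2 • (J (k + 1) ^ (2 * n + 2)) ((J k ^ (j + 1)) w))
          + ((J (k + 1) ^ (2 * n)) ((J k ^ (j + 1)) x) - (J k ^ n) ((J k ^ (j + 1)) x)) := by
      rw [mul_add, mul_one, pow_add, Module.End.mul_apply, hs, map_add, map_neg, map_smul,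
        pow_succ (J k) n, Module.End.mul_apply (J k ^ n), pow_add, Module.End.mul_apply,
        pow_succ' (J k) j, Module.End.mul_apply, Module.End.mul_apply]
      abel
    rw [e]
    refine (map_add_le_add p _ _).trans ?_
    rw [map_neg_eq_map, map_smul_eq_mul, norm_pow, norm_inv, norm_pow, RCLike.norm_ofNat]
    have h1 := mul_le_mul_of_nonneg_left (hpq' (k + 1) (2 * n + 2) k (j + 1) w)
      (by positivity : (0 : ℝ) ≤ (2 ^ (k + 1))⁻¹ ^ 2)
    push_cast
    linarith [ih (j + 1)]

include hpq

/-- The fine floor is twice the coarse one or one more. The possible extra step costs at most `2⁻ᵏ q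
y`; the `n ≤ t 2ᵏ` replacements cost `O(4⁻ᵏ)` each. -/
theorem floor_succ_sub_le {x y w : E} (hx : (x, y) ∈ B.graph) (hy : (y, w) ∈ B.graph)
    (t : ℝ≥0) (k : ℕ) :
    p ((J (k + 1) ^ ⌊t * 2 ^ (k + 1)⌋₊) x - (J k ^ ⌊t * 2 ^ k⌋₊) x)
      ≤ (2 ^ k)⁻¹ * (t * q w + q y) := by
  set n := ⌊t * 2 ^ k⌋₊ with hn
  have hn1 : (n : ℝ≥0) ≤ t * 2 ^ k := Nat.floor_le (by positivity)
  have hn2 : t * 2 ^ k < (n : ℝ≥0) + 1 := Nat.lt_floor_add_one _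
  set m := ⌊t * 2 ^ (k + 1)⌋₊ with hm
  have hm1 : 2 * n ≤ m := by
    refine Nat.le_floor ?_
    rw [pow_succ, ← mul_assoc]; push_cast
    rw [mul_comm (2 : ℝ≥0)]; gcongr
  have hm2 : m < 2 * n + 2 := by
    refine (Nat.floor_lt (by positivity)).2 ?_
    rw [pow_succ, ← mul_assoc]; push_cast
    calc _ < ((n : ℝ≥0) + 1) * 2 := by gcongr
      _ = _ := by ring
  have h1 := hJ.pow_sub_pow_le hpq hx (k + 1) hm1
  have h2 := hJ.pow_two_mul_sub_pow_le hpq' hx hy k n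
  rw [← sub_add_sub_cancel _ ((J (k + 1) ^ (2 * n)) x)]
  refine (map_add_le_add p _ _).trans ((add_le_add h1 h2).trans ?_)
  have hq1 : 0 ≤ q y := apply_nonneg q y
  have hq2 : 0 ≤ q w := apply_nonneg q w
  have a1 : ((m : ℝ) - (2 * n : ℕ)) ≤ 1 := by
    have : (m : ℝ) + 1 ≤ (2 * n + 2 : ℕ) := by exact_mod_cast hm2
    push_cast at *; linarith
  have a2 : (n : ℝ) ≤ t * 2 ^ k := by exact_mod_cast hn1
  have hpos : (0 : ℝ) < 2 ^ k := by positivity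
  have b1 : ((m : ℝ) - (2 * n : ℕ)) * (2 ^ (k + 1))⁻¹ * q y ≤ 1 * (2 ^ k)⁻¹ * q y := by
    gcongr
    · norm_num
    · omega
  have b2 : (n : ℝ) * ((2 ^ (k + 1))⁻¹ ^ 2 * q w) ≤ (t * 2 ^ k) * ((2 ^ k)⁻¹ ^ 2 * q w) := by
    gcongr
    · norm_num
    · omega
  have b3 : ((t : ℝ) * 2 ^ k) * ((2 ^ k)⁻¹ ^ 2 * q w) = (2 ^ k)⁻¹ * (t * q w) := by field_simp
  linarith

/-- The constant is the geometric sum of `2⁻ⁱ` over `k ≤ i < k + j`. -/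
theorem floor_add_sub_le {x y w : E} (hx : (x, y) ∈ B.graph) (hy : (y, w) ∈ B.graph)
    (t : ℝ≥0) (k j : ℕ) :
    p ((J (k + j) ^ ⌊t * 2 ^ (k + j)⌋₊) x - (J k ^ ⌊t * 2 ^ k⌋₊) x)
      ≤ (2 * (2 ^ k)⁻¹ - 2 * (2 ^ (k + j))⁻¹) * (t * q w + q y) := by
  induction j with
  | zero => simp
  | succ j ih =>
    have h := hJ.floor_succ_sub_le hpq hpq' hx hy t (k + j)
    rw [← add_assoc, ← sub_add_sub_cancel _ ((J (k + j) ^ ⌊t * 2 ^ (k + j)⌋₊) x)]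
    refine (map_add_le_add p _ _).trans ((add_le_add h ih).trans (le_of_eq ?_))
    rw [pow_succ _ (k + j)]
    field_simp
    ring

end Cauchy

/-- The domain of `B²` is dense: for `z` in the domain of `B`, `J k z` lies in that of `B²` and
tends to `z`. -/
theorem exists_graph_sq_close [TopologicalSpace E] [PolynormableSpace 𝕜 E] {B : E →ₗ.[𝕜] E}
    {J : ℕ → E →ₗ[𝕜] E} (hJ : IsEulerScheme B J) (x : E) {p : Seminorm 𝕜 E} (hp : Continuous p)
    {ε : ℝ} (hε : 0 < ε) :
    ∃ z y w, (z, y) ∈ B.graph ∧ (y, w) ∈ B.graph ∧ p (x - z) < ε := by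
  obtain ⟨q, hq, -, hpq, -⟩ := hJ.exists_seminorm p hp
  obtain ⟨z, hz, hxz⟩ := exists_seminorm_sub_lt_of_dense 𝕜 hJ.dense x hp (half_pos hε)
  obtain ⟨y, hy⟩ := LinearPMap.mem_domain_iff.1 hz
  have hlim : Tendsto (fun k : ℕ => (2 ^ k : ℝ)⁻¹ * q y) atTop (𝓝 0) := by
    have := (tendsto_inv_atTop_zero.comp
      (tendsto_pow_atTop_atTop_of_one_lt (one_lt_two (α := ℝ)))).mul_const (q y)
    simpa using this
  obtain ⟨k, hk⟩ := (hlim.eventually_lt_const (half_pos hε)).exists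
  refine ⟨J k z, J k y, _, hJ.apply_mem_graph hy k, hJ.apply_mem k y, ?_⟩
  have h := hJ.pow_sub_pow_le hpq hy k (Nat.zero_le 1)
  rw [map_sub_rev] at h
  rw [← sub_add_sub_cancel x z]
  refine (map_add_le_add p _ _).trans_lt ?_
  simp only [pow_zero, pow_one, Module.End.one_apply, Nat.cast_one, Nat.cast_zero, sub_zero,
    one_mul] at h
  linarith

theorem exists_tendsto [UniformSpace E] [IsUniformAddGroup E] [PolynormableSpace 𝕜 E]
    (hE : SeqComplete E) {B : E →ₗ.[𝕜] E} {J : ℕ → E →ₗ[𝕜] E} (hJ : IsEulerScheme B J)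
    (t : ℝ≥0) (x : E) :
    ∃ y, Tendsto (fun k => (J k ^ ⌊t * 2 ^ k⌋₊) x) atTop (𝓝 y) := by
  refine hE _ (cauchySeq_of_seminorm 𝕜 fun p hp ε hε => ?_)
  obtain ⟨q, hq, -, hpq, hpq'⟩ := hJ.exists_seminorm p hp
  -- Two errors from replacing `x` by `z` and one tail, each below `ε / 6`, leave `ε / 2` for the
  -- distance to the `N`-th term.
  obtain ⟨z, y, w, hz, hy, hxz⟩ := hJ.exists_graph_sq_close x hq (show 0 < ε / 6 by positivity)
  set C := (t : ℝ) * q w + q y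
  have hC : 0 ≤ C := by positivity
  have hlim : Tendsto (fun k : ℕ => 2 * (2 ^ k : ℝ)⁻¹ * C) atTop (𝓝 0) := by
    have := ((tendsto_inv_atTop_zero.comp
      (tendsto_pow_atTop_atTop_of_one_lt (one_lt_two (α := ℝ)))).const_mul 2).mul_const C
    simpa using this
  obtain ⟨N, hN⟩ := (hlim.eventually_lt_const (show 0 < ε / 6 by positivity)).exists
  have hclose : ∀ m ≥ N, p ((J m ^ ⌊t * 2 ^ m⌋₊) x - (J N ^ ⌊t * 2 ^ N⌋₊) x) < ε / 2 := by
    intro m hm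
    obtain ⟨j, rfl⟩ := Nat.exists_eq_add_of_le hm
    have h1 := hJ.floor_add_sub_le hpq hpq' hz hy t N j
    have h2 : (2 * (2 ^ N : ℝ)⁻¹ - 2 * (2 ^ (N + j))⁻¹) * C ≤ 2 * (2 ^ N : ℝ)⁻¹ * C := by
      gcongr
      have : (0 : ℝ) ≤ 2 * (2 ^ (N + j))⁻¹ := by positivity
      linarith
    have h3 := hpq (N + j) ⌊t * 2 ^ (N + j)⌋₊ (x - z)
    have h4 := hpq N ⌊t * 2 ^ N⌋₊ (x - z)
    have e : (J (N + j) ^ ⌊t * 2 ^ (N + j)⌋₊) x - (J N ^ ⌊t * 2 ^ N⌋₊) x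
        = (J (N + j) ^ ⌊t * 2 ^ (N + j)⌋₊) (x - z) + -(J N ^ ⌊t * 2 ^ N⌋₊) (x - z)
          + ((J (N + j) ^ ⌊t * 2 ^ (N + j)⌋₊) z - (J N ^ ⌊t * 2 ^ N⌋₊) z) := by
      simp only [map_sub]; abel
    rw [e]
    refine ((map_add_le_add p _ _).trans (add_le_add_left (map_add_le_add p _ _) _)).trans_lt ?_
    rw [map_neg_eq_map]
    linarith
  refine ⟨N, fun m hm n hn => ?_⟩
  rw [← sub_add_sub_cancel _ ((J N ^ ⌊t * 2 ^ N⌋₊) x)]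
  refine (map_add_le_add p _ _).trans_lt ?_
  have := hclose n hn
  rw [map_sub_rev] at this
  linarith [hclose m hm]

end IsEulerScheme

end EulerScheme

/-! ### The limit semigroup and its generator. -/

section Limit

variable {𝕜 E : Type*} [RCLike 𝕜] [AddCommGroup E] [Module 𝕜 E]

/-- Uniform continuity of the operators `Ω s` for `s` in bounded sets. -/
def LocallyEquicontinuous [TopologicalSpace E] (Ω : ℝ≥0 → E →L[𝕜] E) : Prop :=
  ∀ (c : ℝ≥0) (p : Seminorm 𝕜 E), Continuous p →
    ∃ q : Seminorm 𝕜 E, Continuous q ∧ ∀ s ≤ c, ∀ x, p (Ω s x) ≤ q x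

theorem tendsto_floor_mul_two_pow (t : ℝ≥0) :
    Tendsto (fun k : ℕ => (⌊t * 2 ^ k⌋₊ : ℝ) * (2 ^ k)⁻¹) atTop (𝓝 t) := by
  have h := (tendsto_nat_floor_mul_div_atTop (R := ℝ) t.2).comp
    (tendsto_pow_atTop_atTop_of_one_lt (one_lt_two (α := ℝ)))
  refine h.congr fun k => ?_
  simp only [Function.comp_apply, div_eq_mul_inv, NNReal.val_eq_coe]
  congr 2

theorem tendsto_inv_two_pow : Tendsto (fun k : ℕ => ((2 : ℝ) ^ k)⁻¹) atTop (𝓝 0) :=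
  tendsto_inv_atTop_zero.comp (tendsto_pow_atTop_atTop_of_one_lt one_lt_two)

theorem floor_add_mul_two_pow (s t : ℝ≥0) (k : ℕ) :
    ⌊s * 2 ^ k⌋₊ + ⌊t * 2 ^ k⌋₊ ≤ ⌊(s + t) * 2 ^ k⌋₊ ∧
      ⌊(s + t) * 2 ^ k⌋₊ ≤ ⌊s * 2 ^ k⌋₊ + ⌊t * 2 ^ k⌋₊ + 1 := by
  have h1 := Nat.floor_le (zero_le (a := s * 2 ^ k))
  have h2 := Nat.floor_le (zero_le (a := t * 2 ^ k))
  constructor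
  · refine Nat.le_floor ?_
    push_cast
    rw [add_mul]
    exact add_le_add h1 h2
  · refine Nat.lt_succ_iff.1 ((Nat.floor_lt zero_le).2 ?_)
    have h3 := Nat.lt_floor_add_one (s * 2 ^ k)
    have h4 := Nat.lt_floor_add_one (t * 2 ^ k)
    push_cast
    rw [add_mul]
    calc _ < ((⌊s * 2 ^ k⌋₊ : ℝ≥0) + 1) + ((⌊t * 2 ^ k⌋₊ : ℝ≥0) + 1) := add_lt_add h3 h4
      _ = _ := by ring

namespace IsEulerScheme

theorem exists_limit [UniformSpace E] [IsUniformAddGroup E] [ContinuousSMul 𝕜 E]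
    [PolynormableSpace 𝕜 E] [T2Space E] (hE : SeqComplete E) {B : E →ₗ.[𝕜] E}
    {J : ℕ → E →ₗ[𝕜] E} (hJ : IsEulerScheme B J) :
    ∃ T : ℝ≥0 → E →L[𝕜] E, ∀ t x,
      Tendsto (fun k => (J k ^ ⌊t * 2 ^ k⌋₊) x) atTop (𝓝 (T t x)) := by
  choose f hf using hJ.exists_tendsto hE
  have hlim : ∀ t, Tendsto (fun k x => (J k ^ ⌊t * 2 ^ k⌋₊) x) atTop (𝓝 (f t)) :=
    fun t => tendsto_pi_nhds.2 (hf t)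
  refine ⟨fun t => ⟨linearMapOfTendsto (f t) (fun k => J k ^ ⌊t * 2 ^ k⌋₊) (hlim t), ?_⟩, hf⟩
  refine continuous_of_seminorm_le _ fun p hp => ?_
  obtain ⟨q, hq, -, hpq, -⟩ := hJ.exists_seminorm p hp
  exact ⟨q, hq, fun x => le_of_tendsto (seminorm_tendsto hp (hf t x))
    (Eventually.of_forall fun k => hpq _ _ x)⟩

section

variable [TopologicalSpace E] {B : E →ₗ.[𝕜] E} {J : ℕ → E →ₗ[𝕜] E} {T : ℝ≥0 → E →L[𝕜] E}
  (hT : ∀ t x, Tendsto (fun k => (J k ^ ⌊t * 2 ^ k⌋₊) x) atTop (𝓝 (T t x)))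
  {p q : Seminorm 𝕜 E} (hp : Continuous p) (hpq : ∀ k n x, p ((J k ^ n) x) ≤ q x)
include hT hp hpq

theorem seminorm_limit_le (t : ℝ≥0) (x : E) : p (T t x) ≤ q x :=
  le_of_tendsto (seminorm_tendsto hp (hT t x)) (Eventually.of_forall fun _ => hpq _ _ x)

variable [IsTopologicalAddGroup E] (hJ : IsEulerScheme B J)
include hJ

theorem seminorm_limit_sub_le {x y : E} (h : (x, y) ∈ B.graph) {s t : ℝ≥0} (hst : s ≤ t) :
    p (T t x - T s x) ≤ ((t : ℝ) - s) * q y := by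
  refine le_of_tendsto_of_tendsto' (seminorm_tendsto hp ((hT t x).sub (hT s x)))
    (((tendsto_floor_mul_two_pow t).sub (tendsto_floor_mul_two_pow s)).mul_const (q y))
    fun k => ?_
  rw [← sub_mul]
  exact hJ.pow_sub_pow_le hpq h k (Nat.floor_mono (by gcongr))

theorem seminorm_limit_sub_sub_smul_le [ContinuousSMul 𝕜 E] {x y z v : E}
    (hx : (x, y) ∈ B.graph) (hz : (z, v) ∈ B.graph) (t : ℝ≥0) :
    p (T t x - x - ((t : ℝ) : 𝕜) • y) ≤ t * (q (y - z) + p (y - z) + t * q v) := by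
  have ht := tendsto_floor_mul_two_pow t
  have ht' : Tendsto (fun k : ℕ => ((⌊t * 2 ^ k⌋₊ : ℕ) : 𝕜) * ((2 : 𝕜) ^ k)⁻¹) atTop
      (𝓝 ((t : ℝ) : 𝕜)) := by
    refine ((RCLike.continuous_ofReal (K := 𝕜)).tendsto _ |>.comp ht).congr fun k => ?_
    simp only [Function.comp_apply]
    push_cast
    rfl
  refine le_of_tendsto_of_tendsto' (seminorm_tendsto hp
    (((hT t x).sub tendsto_const_nhds).sub (ht'.smul_const y)))
    (ht.mul (tendsto_const_nhds.add (ht.mul_const (q v)))) fun k => ?_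
  exact hJ.pow_sub_sub_smul_le hpq hx hz k _

end

section

variable [TopologicalSpace E] [IsTopologicalAddGroup E] [ContinuousSMul 𝕜 E]
  [PolynormableSpace 𝕜 E] [T2Space E] {B : E →ₗ.[𝕜] E} {J : ℕ → E →ₗ[𝕜] E}
  (hJ : IsEulerScheme B J) {T : ℝ≥0 → E →L[𝕜] E}
  (hT : ∀ t x, Tendsto (fun k => (J k ^ ⌊t * 2 ^ k⌋₊) x) atTop (𝓝 (T t x)))
include hJ hT

omit [ContinuousSMul 𝕜 E] in
-- The floor is additive up to one, and one surplus Euler step on a domain vector costs at most `2⁻ᵏ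
-- q y`, which vanishes in the limit.
theorem limit_add (s t : ℝ≥0) : T (s + t) = (T s).comp (T t) := by
  refine ContinuousLinearMap.coeFn_injective (Continuous.ext_on hJ.dense (T (s + t)).continuous
    ((T s).comp (T t)).continuous fun x hx => ?_)
  obtain ⟨y, hy⟩ := LinearPMap.mem_domain_iff.1 hx
  refine eq_of_forall_seminorm_sub_le 𝕜 fun p hp => ?_
  obtain ⟨q, hq, -, hpq, -⟩ := hJ.exists_seminorm p hp
  -- Strong limits may be composed here because equicontinuity controls the outer power uniformly in
  -- `k`.
  have hcomp : Tendsto (fun k => (J k ^ (⌊s * 2 ^ k⌋₊ + ⌊t * 2 ^ k⌋₊)) x) atTop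
      (𝓝 (T s (T t x))) := by
    refine (tendsto_nhds_iff_seminorm 𝕜).2 fun p' hp' ε hε => ?_
    obtain ⟨q', hq', -, hpq', -⟩ := hJ.exists_seminorm p' hp'
    filter_upwards [(tendsto_nhds_iff_seminorm 𝕜).1 (hT t x) q' hq' _ (half_pos hε),
      (tendsto_nhds_iff_seminorm 𝕜).1 (hT s (T t x)) p' hp' _ (half_pos hε)] with k h1 h2
    rw [pow_add, Module.End.mul_apply, ← sub_add_sub_cancel _ ((J k ^ ⌊s * 2 ^ k⌋₊) (T t x)),
      ← map_sub]
    refine (map_add_le_add p' _ _).trans_lt ?_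
    linarith [hpq' k ⌊s * 2 ^ k⌋₊ ((J k ^ ⌊t * 2 ^ k⌋₊) x - T t x)]
  have h0 : Tendsto (fun k : ℕ => ((2 : ℝ) ^ k)⁻¹ * q y) atTop (𝓝 0) := by
    simpa using tendsto_inv_two_pow.mul_const (q y)
  refine le_of_tendsto_of_tendsto' (seminorm_tendsto hp ((hT (s + t) x).sub hcomp)) h0 fun k => ?_
  obtain ⟨h1, h2⟩ := floor_add_mul_two_pow s t k
  refine (hJ.pow_sub_pow_le hpq hy k h1).trans ?_
  have h2' : ((⌊(s + t) * 2 ^ k⌋₊ : ℕ) : ℝ) - (⌊s * 2 ^ k⌋₊ + ⌊t * 2 ^ k⌋₊ : ℕ) ≤ 1 := by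
    rw [sub_le_iff_le_add']
    exact_mod_cast h2
  have := mul_le_mul_of_nonneg_right h2'
    (mul_nonneg (by positivity : (0 : ℝ) ≤ (2 ^ k)⁻¹) (apply_nonneg q y))
  linarith

omit [IsTopologicalAddGroup E] [ContinuousSMul 𝕜 E] [PolynormableSpace 𝕜 E] hJ in
theorem limit_zero : T 0 = ContinuousLinearMap.id 𝕜 E := by
  ext x
  refine tendsto_nhds_unique (hT 0 x) ?_
  simp

omit [ContinuousSMul 𝕜 E] [T2Space E] in
theorem limit_strongly_continuous (x : E) : Continuous fun t => T t x := by
  rw [continuous_iff_continuousAt]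
  intro t
  refine (tendsto_nhds_iff_seminorm 𝕜).2 fun p hp ε hε => ?_
  obtain ⟨q, hq, -, hpq, -⟩ := hJ.exists_seminorm p hp
  obtain ⟨z, hz, hxz⟩ := exists_seminorm_sub_lt_of_dense 𝕜 hJ.dense x hq
    (show 0 < ε / 3 by positivity)
  obtain ⟨y, hy⟩ := LinearPMap.mem_domain_iff.1 hz
  have hcont : Continuous fun s : ℝ≥0 => |(s : ℝ) - t| * q y := by fun_prop
  have h0 := (hcont.tendsto t).eventually_lt_const (show _ < ε / 3 by simpa using hε)
  filter_upwards [h0] with s hs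
  have h1 : p (T s z - T t z) ≤ |(s : ℝ) - t| * q y := by
    rcases le_total t s with h | h
    · rw [abs_of_nonneg (sub_nonneg.2 (NNReal.coe_le_coe.2 h))]
      exact seminorm_limit_sub_le hT hp hpq hJ hy h
    · rw [map_sub_rev, abs_sub_comm, abs_of_nonneg (sub_nonneg.2 (NNReal.coe_le_coe.2 h))]
      exact seminorm_limit_sub_le hT hp hpq hJ hy h
  have e : T s x - T t x = T s (x - z) + -T t (x - z) + (T s z - T t z) := by
    simp only [map_sub]; abel
  rw [e]
  refine ((map_add_le_add p _ _).trans (add_le_add_left (map_add_le_add p _ _) _)).trans_lt ?_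
  rw [map_neg_eq_map]
  linarith [seminorm_limit_le hT hp hpq s (x - z), seminorm_limit_le hT hp hpq t (x - z)]

omit [IsTopologicalAddGroup E] [ContinuousSMul 𝕜 E] in
theorem limit_commute (t : ℝ≥0) (k : ℕ) (x : E) : T t (J k x) = J k (T t x) := by
  have hc : Continuous (J k) := continuous_of_seminorm_le _ fun p hp => by
    obtain ⟨q, hq, -, hpq, -⟩ := hJ.exists_seminorm p hp
    exact ⟨q, hq, fun x => by simpa using hpq k 1 x⟩
  refine tendsto_nhds_unique (hT t (J k x)) (((hc.tendsto _).comp (hT t x)).congr fun l => ?_)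
  exact LinearMap.congr_fun ((hJ.commute k l).pow_right ⌊t * 2 ^ l⌋₊) x

omit [T2Space E] in
theorem tendsto_limit_of_mem_graph {x y : E} (hx : (x, y) ∈ B.graph) :
    Tendsto (fun h : ℝ≥0 => (((h : ℝ)⁻¹ : ℝ) : 𝕜) • (T h x - x)) (𝓝[>] 0) (𝓝 y) := by
  refine (tendsto_nhds_iff_seminorm 𝕜).2 fun p hp ε hε => ?_
  obtain ⟨q, hq, hp_le, hpq, -⟩ := hJ.exists_seminorm p hp
  obtain ⟨z, hz, hyz⟩ := exists_seminorm_sub_lt_of_dense 𝕜 hJ.dense y hq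
    (show 0 < ε / 3 by positivity)
  obtain ⟨v, hv⟩ := LinearPMap.mem_domain_iff.1 hz
  have hcont : Continuous fun s : ℝ≥0 => (s : ℝ) * q v := by fun_prop
  have h0 := ((hcont.tendsto 0).mono_left (nhdsWithin_le_nhds (s := Set.Ioi 0))).eventually_lt_const
    (show _ < ε / 3 by simpa using hε)
  filter_upwards [h0, self_mem_nhdsWithin] with h hh hpos
  have hpos' : (0 : ℝ) < h := NNReal.coe_pos.2 hpos
  have hb := seminorm_limit_sub_sub_smul_le hT hp hpq hJ hx hv h
  have e : (((h : ℝ)⁻¹ : ℝ) : 𝕜) • (T h x - x) - y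
      = (((h : ℝ)⁻¹ : ℝ) : 𝕜) • (T h x - x - ((h : ℝ) : 𝕜) • y) := by
    rw [smul_sub _ (T h x - x), smul_smul, ← RCLike.ofReal_mul, inv_mul_cancel₀ hpos'.ne',
      RCLike.ofReal_one, one_smul]
  rw [e, seminorm_smul_ofReal p (inv_nonneg.2 hpos'.le), inv_mul_lt_iff₀ hpos']
  refine hb.trans_lt (mul_lt_mul_of_pos_left ?_ hpos')
  linarith [hp_le (y - z)]

/-- The generator of `T` extends `B`. Conversely, if the difference quotients at `x` tend to `y`,
applying `J 0 = (1 - B)⁻¹`, which commutes with `T`, gives `J 0 y = B (J 0 x) = J 0 x - x`. Hence `x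
= J 0 (x - y)` lies in the domain and `B x = y`. -/
theorem generates_limit : Generates B T := by
  refine ⟨⟨limit_zero hT, limit_add hJ hT, limit_strongly_continuous hJ hT⟩, fun x y => ?_⟩
  have hgraph : ∀ {x y : E}, (∃ h : x ∈ B.domain, B ⟨x, h⟩ = y) ↔ (x, y) ∈ B.graph := by
    intro x y
    simp [LinearPMap.mem_graph_iff]
  rw [hgraph]
  refine ⟨tendsto_limit_of_mem_graph hJ hT, fun h => ?_⟩
  have hc : Continuous (J 0) := continuous_of_seminorm_le _ fun p hp => by
    obtain ⟨q, hq, -, hpq, -⟩ := hJ.exists_seminorm p hp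
    exact ⟨q, hq, fun x => by simpa using hpq 0 1 x⟩
  have h1 := (hc.tendsto _).comp h
  have h2 := tendsto_limit_of_mem_graph hJ hT (hJ.apply_mem 0 x)
  have h3 : J 0 y = (2 : 𝕜) ^ 0 • (J 0 x - x) := by
    refine tendsto_nhds_unique h1 (h2.congr fun s => ?_)
    simp only [Function.comp_apply, map_smul, map_sub, limit_commute hJ hT]
  have h4 : J 0 (x - y) = x := by
    rw [map_sub, h3, pow_zero, one_smul, sub_sub_cancel]
  have h5 := (hJ.apply_eq_iff 0 x (x - y)).1 h4
  simpa using h5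

omit [IsTopologicalAddGroup E] [ContinuousSMul 𝕜 E] [PolynormableSpace 𝕜 E] [T2Space E] in
theorem locallyEquicontinuous_limit : LocallyEquicontinuous T := fun _ p hp => by
  obtain ⟨q, hq, -, hpq, -⟩ := hJ.exists_seminorm p hp
  exact ⟨q, hq, fun s _ x => seminorm_limit_le hT hp hpq s x⟩

end

end IsEulerScheme

end Limit

/-! ### From the Hille–Yosida condition to a semigroup, by shifting the operator. -/

section HilleYosida

variable {𝕜 E : Type*} [RCLike 𝕜] [AddCommGroup E] [Module 𝕜 E]

/-- The operator `A - c`. -/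
def shift (A : E →ₗ.[𝕜] E) (c : 𝕜) : E →ₗ.[𝕜] E where
  domain := A.domain
  toFun := A.toFun - c • A.domain.subtype

theorem shift_apply_eq_iff (A : E →ₗ.[𝕜] E) (c : 𝕜) (x y : E) :
    (∃ h : x ∈ (shift A c).domain, shift A c ⟨x, h⟩ = y) ↔
      ∃ h : x ∈ A.domain, A ⟨x, h⟩ = y + c • x :=
  exists_congr fun _ => sub_eq_iff_eq_add

theorem mem_graph_iff_exists (A : E →ₗ.[𝕜] E) (x y : E) :
    (x, y) ∈ A.graph ↔ ∃ h : x ∈ A.domain, A ⟨x, h⟩ = y := by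
  simp [LinearPMap.mem_graph_iff]

theorem HilleYosidaCondition.exists_isEulerScheme [TopologicalSpace E] {A : E →ₗ.[𝕜] E}
    (hA : HilleYosidaCondition A) :
    ∃ (c : ℝ) (J : ℕ → E →ₗ[𝕜] E), IsEulerScheme (shift A (c : 𝕜)) J := by
  obtain ⟨hdense, c, R, hR, hequi⟩ := hA
  have h1 : ∀ k : ℕ, (1 : ℝ) ≤ 2 ^ k := fun k => one_le_pow₀ one_le_two
  -- For `λ = 2ᵏ ≥ 1`, `λ (c + λ - A)⁻¹ = (1 - λ⁻¹(A - c))⁻¹`.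
  refine ⟨c, fun k => (((2 ^ k : ℝ)) : 𝕜) • R (c + 2 ^ k), hdense, fun k x z => ?_, ?_⟩
  · rw [LinearMap.smul_apply, ← map_smul, hR _ (h1 k), mem_graph_iff_exists, shift_apply_eq_iff]
    refine exists_congr fun _ => ?_
    have e : ((2 ^ k : ℝ) : 𝕜) = (2 : 𝕜) ^ k := by push_cast; rfl
    rw [RCLike.ofReal_add, e, add_smul, sub_eq_iff_eq_add, smul_sub]
    constructor <;> intro h
    · rw [sub_add_eq_add_sub, add_comm _ ((c : 𝕜) • x), h]; abel
    · rw [h]; abel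
  · intro p hp
    obtain ⟨q, hq, h⟩ := hequi p hp
    exact ⟨q, hq, fun θ x => h (⟨2 ^ θ.1, h1 _⟩, θ.2) x⟩

theorem tendsto_inv_smul_exp_sub_one (c : ℝ) :
    Tendsto (fun h : ℝ≥0 => (h : ℝ)⁻¹ * (Real.exp (c * h) - 1)) (𝓝[>] 0) (𝓝 c) := by
  have hd : HasDerivAt (fun s : ℝ => Real.exp (c * s)) c 0 := by
    simpa using ((hasDerivAt_id (0 : ℝ)).const_mul c).exp
  have hcoe : Tendsto (fun h : ℝ≥0 => (h : ℝ)) (𝓝[>] 0) (𝓝[≠] 0) :=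
    tendsto_nhdsWithin_iff.2 ⟨(NNReal.continuous_coe.tendsto 0).mono_left nhdsWithin_le_nhds, by
      filter_upwards [self_mem_nhdsWithin] with h hh
      exact (NNReal.coe_pos.2 hh).ne'⟩
  refine (hd.tendsto_slope_zero.comp hcoe).congr fun h => ?_
  simp

theorem tendsto_exp_mul_nhdsGT (c : ℝ) :
    Tendsto (fun h : ℝ≥0 => ((Real.exp (c * h) : ℝ) : 𝕜)) (𝓝[>] 0) (𝓝 1) := by
  have : Continuous fun h : ℝ≥0 => ((Real.exp (c * h) : ℝ) : 𝕜) :=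
    RCLike.continuous_ofReal.comp (by fun_prop)
  simpa using (this.tendsto 0).mono_left nhdsWithin_le_nhds

/-- If `A - c` generates `T`, then `A` generates `eᶜᵗ T(t)`. -/
theorem Generates.exp_smul [TopologicalSpace E] [IsTopologicalAddGroup E] [ContinuousSMul 𝕜 E]
    {A : E →ₗ.[𝕜] E} {c : ℝ} {T : ℝ≥0 → E →L[𝕜] E} (hT : Generates (shift A (c : 𝕜)) T) :
    Generates A fun t => ((Real.exp (c * t) : ℝ) : 𝕜) • T t := by
  refine ⟨⟨by simp [hT.1.zero], fun s t => ?_, fun x => ?_⟩, fun x y => ?_⟩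
  · ext x
    simp only [hT.1.add, NNReal.coe_add, mul_add, Real.exp_add, RCLike.ofReal_mul,
      smul_apply, ContinuousLinearMap.comp_apply, map_smul, smul_smul]
    rw [mul_comm]
  · have : Continuous fun h : ℝ≥0 => ((Real.exp (c * h) : ℝ) : 𝕜) :=
      RCLike.continuous_ofReal.comp (by fun_prop)
    exact this.smul (hT.1.strongly_continuous x)
  · have hshift : (∃ h : x ∈ A.domain, A ⟨x, h⟩ = y) ↔
        ∃ h : x ∈ (shift A (c : 𝕜)).domain, shift A (c : 𝕜) ⟨x, h⟩ = y - (c : 𝕜) • x := by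
      rw [shift_apply_eq_iff, sub_add_cancel]
    rw [hshift, hT.2]
    have hexp := tendsto_exp_mul_nhdsGT (𝕜 := 𝕜) c
    have hexp' : Tendsto (fun h : ℝ≥0 => (((h : ℝ)⁻¹ * (Real.exp (c * h) - 1) : ℝ) : 𝕜) • x)
        (𝓝[>] 0) (𝓝 ((c : 𝕜) • x)) :=
      ((RCLike.continuous_ofReal.tendsto c).comp (tendsto_inv_smul_exp_sub_one c)).smul_const x
    constructor <;> intro h
    · have := (hexp.smul h).add hexp'
      rw [one_smul, sub_add_cancel] at this
      refine this.congr fun s => ?_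
      rw [smul_apply]
      push_cast
      module
    · have hexp_inv : Tendsto (fun h : ℝ≥0 => ((Real.exp (c * h) : ℝ) : 𝕜)⁻¹) (𝓝[>] 0) (𝓝 1) := by
        simpa using hexp.inv₀ one_ne_zero
      have := hexp_inv.smul (h.sub hexp')
      rw [one_smul] at this
      refine this.congr fun s => ?_
      have hne : ((Real.exp (c * s) : ℝ) : 𝕜) ≠ 0 := RCLike.ofReal_ne_zero.2 (Real.exp_pos _).ne'
      rw [inv_smul_eq_iff₀ hne, smul_apply]
      push_cast
      module

theorem LocallyEquicontinuous.exp_smul [TopologicalSpace E] [ContinuousSMul 𝕜 E]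
    {T : ℝ≥0 → E →L[𝕜] E} (hT : LocallyEquicontinuous T) (c : ℝ) :
    LocallyEquicontinuous fun t => ((Real.exp (c * t) : ℝ) : 𝕜) • T t := by
  intro b p hp
  obtain ⟨q, hq, h⟩ := hT b p hp
  refine ⟨(Real.exp (|c| * b)).toNNReal • q, ?_, fun s hs x => ?_⟩
  · change Continuous fun x => (Real.exp (|c| * b)).toNNReal • q x
    exact hq.const_smul _
  · rw [smul_apply, seminorm_smul_ofReal p (Real.exp_pos _).le]
    change _ ≤ ((Real.exp (|c| * b)).toNNReal : ℝ) * q x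
    rw [Real.coe_toNNReal _ (Real.exp_pos _).le]
    have hs' : (s : ℝ) ≤ b := by exact_mod_cast hs
    have := h s hs x
    gcongr
    exact le_abs_self c

theorem HilleYosidaCondition.exists_generates [UniformSpace E] [IsUniformAddGroup E]
    [ContinuousSMul 𝕜 E] [PolynormableSpace 𝕜 E] [T2Space E] (hE : SeqComplete E)
    {A : E →ₗ.[𝕜] E} (hA : HilleYosidaCondition A) :
    ∃ Ω : ℝ≥0 → E →L[𝕜] E, Generates A Ω ∧ LocallyEquicontinuous Ω := by
  obtain ⟨c, J, hJ⟩ := hA.exists_isEulerScheme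
  obtain ⟨T, hT⟩ := hJ.exists_limit hE
  exact ⟨_, (hJ.generates_limit hT).exp_smul, (hJ.locallyEquicontinuous_limit hT).exp_smul c⟩

end HilleYosida

/-! ### Differentiating `T(t - τ) S(τ) x`, and uniqueness. -/

section Duhamel

variable {𝕜 E : Type*} [RCLike 𝕜] [AddCommGroup E] [Module 𝕜 E]

/-- Strong continuity alone handles a fixed vector; local equicontinuity on `[0, s + 1]` absorbs the
moving one. -/
theorem LocallyEquicontinuous.tendsto_apply [TopologicalSpace E] [PolynormableSpace 𝕜 E]
    {T : ℝ≥0 → E →L[𝕜] E}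
    (hT : LocallyEquicontinuous T) (hc : ∀ x, Continuous fun t => T t x) {ι : Type*}
    {l : Filter ι} {u : ι → ℝ≥0} {v : ι → E} {s : ℝ≥0} {x : E} (hu : Tendsto u l (𝓝 s))
    (hv : Tendsto v l (𝓝 x)) : Tendsto (fun i => T (u i) (v i)) l (𝓝 (T s x)) := by
  refine (tendsto_nhds_iff_seminorm 𝕜).2 fun p hp ε hε => ?_
  obtain ⟨q, hq, h⟩ := hT (s + 1) p hp
  filter_upwards [hu.eventually_le_const (lt_add_one s),
    (tendsto_nhds_iff_seminorm 𝕜).1 hv q hq _ (half_pos hε),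
    (tendsto_nhds_iff_seminorm 𝕜).1 (((hc x).tendsto s).comp hu) p hp _ (half_pos hε)]
    with i h1 h2 h3
  rw [← sub_add_sub_cancel _ (T (u i) x), ← map_sub]
  refine (map_add_le_add p _ _).trans_lt ?_
  have h3' : p (T (u i) x - T s x) < ε / 2 := h3
  linarith [h _ h1 (v i - x)]

variable [TopologicalSpace E]

theorem Generates.apply_mem_domain {A : E →ₗ.[𝕜] E} {S : ℝ≥0 → E →L[𝕜] E}
    (hS : Generates A S) (s : ℝ≥0) {x : E} (hx : x ∈ A.domain) : S s x ∈ A.domain := by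
  have h := (hS.2 x _).1 ⟨hx, rfl⟩
  refine ((hS.2 (S s x) (S s (A ⟨x, hx⟩))).2 ?_).1
  refine (((S s).continuous.tendsto _).comp h).congr fun t => ?_
  simp only [Function.comp_apply, map_smul, map_sub]
  rw [← ContinuousLinearMap.comp_apply (S t), ← hS.1.add, add_comm, hS.1.add,
    ContinuousLinearMap.comp_apply]

theorem IsC0Semigroup.continuous_apply_tsub [PolynormableSpace 𝕜 E]
    {T : ℝ≥0 → E →L[𝕜] E} (hT : IsC0Semigroup T) (hTe : LocallyEquicontinuous T)
    (t : ℝ≥0) {v : ℝ≥0 → E} (hv : Continuous v) : Continuous fun τ => T (t - τ) (v τ) :=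
  continuous_iff_continuousAt.2 fun s => hTe.tendsto_apply hT.strongly_continuous
    ((by fun_prop : Continuous fun τ : ℝ≥0 => t - τ).tendsto s) (hv.tendsto s)

variable [IsTopologicalAddGroup E] [PolynormableSpace 𝕜 E]
  {A A' : E →ₗ.[𝕜] E} {T S : ℝ≥0 → E →L[𝕜] E} {D : E →L[𝕜] E}

/-- The quotient is `T(t - s - h)` applied to the difference of the quotients of `S` and `T` at `S s
x`. That vector stays in the common domain, so the difference tends to `(A' - A)(S s x) = D (S s
x)`. -/
theorem Generates.hasRightDeriv (hT : Generates A T) (hS : Generates A' S)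
    (hTe : LocallyEquicontinuous T) (hdom : A'.domain = A.domain)
    (hD : ∀ (x : E) (h₀ : x ∈ A.domain) (h₁ : x ∈ A'.domain), A' ⟨x, h₁⟩ - A ⟨x, h₀⟩ = D x)
    {x : E} (hx : x ∈ A'.domain) {s t : ℝ≥0} (hst : s < t) :
    HasRightDeriv 𝕜 (fun τ => T (t - τ) (S τ x)) (T (t - s) (D (S s x))) s := by
  have h1 : S s x ∈ A'.domain := hS.apply_mem_domain s hx
  have h0 : S s x ∈ A.domain := hdom ▸ h1
  have hlim := ((hS.2 _ _).1 ⟨h1, rfl⟩).sub ((hT.2 _ _).1 ⟨h0, rfl⟩)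
  rw [hD] at hlim
  have hu : Tendsto (fun h : ℝ≥0 => t - (s + h)) (𝓝[>] 0) (𝓝 (t - s)) := by
    have : Continuous fun h : ℝ≥0 => t - (s + h) := by fun_prop
    simpa using (this.tendsto 0).mono_left nhdsWithin_le_nhds
  refine (hTe.tendsto_apply hT.1.strongly_continuous hu hlim).congr' ?_
  -- For `h ≤ t - s` the truncated subtraction in `ℝ≥0` is a true one.
  filter_upwards [mem_nhdsWithin_of_mem_nhds (Iic_mem_nhds (tsub_pos_of_lt hst))] with h hh
  have hh' : h ≤ t - s := hh
  have e1 : t - s = (t - (s + h)) + h := by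
    rw [← tsub_tsub, tsub_add_cancel_of_le hh']
  have e2 : T (t - s) (S s x) = T (t - (s + h)) (T h (S s x)) := by
    conv_lhs => rw [e1, hT.1.add]
    rfl
  have e3 : S (s + h) x = S h (S s x) := by
    rw [add_comm, hS.1.add]; rfl
  rw [e2, e3, ← smul_sub, map_smul, ← map_sub (T (t - (s + h)))]
  congr 2
  abel

/-- With `D = 0`, `τ ↦ T(t - τ) S(τ) x` is constant. Local equicontinuity is needed only for `T`,
the constructed semigroup, so `S` may be any competitor. -/
theorem Generates.unique [ContinuousSMul 𝕜 E] [T2Space E] (hA : Dense (A.domain : Set E))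
    (hT : Generates A T) (hTe : LocallyEquicontinuous T) (hS : Generates A S) : S = T := by
  funext t
  refine ContinuousLinearMap.coeFn_injective (Continuous.ext_on hA (S t).continuous
    (T t).continuous fun x hx => ?_)
  have hc := hT.1.continuous_apply_tsub hTe t (hS.1.strongly_continuous x)
  have := eq_of_hasRightDeriv_zero (𝕜 := 𝕜) (b := t) hc fun s hs => by
    have := hT.hasRightDeriv hS hTe rfl (D := 0) (fun x _ _ => by simp) hx hs
    simpa using this
  simpa [hT.1.zero, hS.1.zero] using this

end Duhamel

/-! ### Riemann sums and the variation of constants formula. -/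

section Integral

variable {𝕜 E : Type*} [RCLike 𝕜] [AddCommGroup E] [Module 𝕜 E] [UniformSpace E]
  [IsUniformAddGroup E] [ContinuousSMul 𝕜 E] [PolynormableSpace 𝕜 E]
  {A A' : E →ₗ.[𝕜] E} {T S : ℝ≥0 → E →L[𝕜] E} {D : E →L[𝕜] E}

/-- The variation of constants formula for the semigroups generated by `A` and `A' = A + D`. -/
theorem Generates.hasStrongIntegral (hA : Dense (A'.domain : Set E)) (hT : Generates A T)
    (hS : Generates A' S) (hTe : LocallyEquicontinuous T) (hSe : LocallyEquicontinuous S)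
    (hdom : A'.domain = A.domain)
    (hD : ∀ (x : E) (h₀ : x ∈ A.domain) (h₁ : x ∈ A'.domain), A' ⟨x, h₁⟩ - A ⟨x, h₀⟩ = D x)
    (t : ℝ≥0) :
    HasStrongIntegral (fun τ : ℝ => (T (t - τ.toNNReal)).comp (D.comp (S τ.toNNReal))) 0 t
      (S t - T t) := by
  intro x U hU
  obtain ⟨p, hp, ε, hε, hpU⟩ := (mem_nhds_iff_seminorm 𝕜).1 hU
  obtain ⟨q₀, hq₀, hT₀⟩ := hTe t p hp
  obtain ⟨q₁, hq₁, hS₁⟩ := hSe t p hp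
  obtain ⟨q₂, hq₂, hD₂⟩ := exists_seminorm_comp_le D q₀ hq₀
  obtain ⟨q₃, hq₃, hS₃⟩ := hSe t q₂ hq₂
  have hbound : ∀ u ≤ t, ∀ v ≤ t, ∀ z, p (T u (D (S v z))) ≤ q₃ z := fun u hu v hv z =>
    (hT₀ u hu _).trans ((hD₂ _).trans (hS₃ v hv z))
  -- The `+ 1` covers `t = 0`; four errors of at most `ε / 4`, some strict, will be added.
  set η := ε / (4 * (t + 1)) with hη
  have ht0 : (0 : ℝ) ≤ t := t.2
  have hηpos : 0 < η := by positivity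
  have hηt : η * t ≤ ε / 4 := by
    rw [hη, div_mul_eq_mul_div, div_le_div_iff₀ (by positivity) (by positivity)]
    nlinarith
  obtain ⟨y, hy, hxy⟩ := exists_seminorm_sub_lt_of_dense 𝕜 hA x (p := q₀ ⊔ q₁ ⊔ q₃)
    ((hq₀.sup hq₁).sup hq₃) (lt_min hηpos (show 0 < ε / 4 by positivity))
  have hy₀ : q₀ (x - y) < ε / 4 := lt_of_le_of_lt
    (le_sup_left.trans le_sup_left) (hxy.trans_le (min_le_right _ _))
  have hy₁ : q₁ (x - y) < ε / 4 := lt_of_le_of_lt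
    (le_sup_right.trans le_sup_left) (hxy.trans_le (min_le_right _ _))
  have hy₃ : q₃ (x - y) < η := lt_of_le_of_lt le_sup_right (hxy.trans_le (min_le_left _ _))
  have hF := hT.1.continuous_apply_tsub hTe t (hS.1.strongly_continuous y)
  have hf := hT.1.continuous_apply_tsub hTe t
    (D.continuous.comp (hS.1.strongly_continuous y))
  obtain ⟨δ, hδ, h⟩ := exists_riemann_sum_close (𝕜 := 𝕜) hF hf
    (fun s hs => hT.hasRightDeriv hS hTe hdom hD hy hs) hp hηpos
  refine ⟨δ, hδ, fun n s ξ h0 hn hs => hpU _ ?_⟩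
  have hsum := h n s ξ h0 hn hs
  simp only [tsub_self, tsub_zero, hT.1.zero, hS.1.zero, ContinuousLinearMap.id_apply,
    Function.comp_apply] at hsum
  simp only [ContinuousLinearMap.comp_apply]
  have hmono' : ∀ k ≤ n, s k ≤ t := by
    intro k hk
    induction hk using Nat.decreasingInduction with
    | self => exact hn.le
    | of_succ k hk ih =>
      have := hs k hk
      linarith
  -- The bound is uniform over partitions because the lengths sum to `t`; this lets `x` be replaced
  -- by the domain vector `y`.
  have hdiff : p (∑ k ∈ Finset.range n, ((s (k + 1) - s k : ℝ) : 𝕜) •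
      T (t - (ξ k).toNNReal) (D (S (ξ k).toNNReal (x - y)))) ≤ t * q₃ (x - y) := by
    calc _ ≤ ∑ k ∈ Finset.range n, (s (k + 1) - s k) * q₃ (x - y) := by
          refine (Finset.le_sum_of_subadditive p (map_zero p).le (map_add_le_add p) _ _).trans
            (Finset.sum_le_sum fun k hk => ?_)
          have hk' := Finset.mem_range.1 hk
          obtain ⟨h1, h2, -⟩ := hs k hk'
          have hd : 0 ≤ s (k + 1) - s k := by linarith
          rw [seminorm_smul_ofReal p hd]
          exact mul_le_mul_of_nonneg_left (hbound _ tsub_le_self _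
            (Real.toNNReal_le_iff_le_coe.2 (h2.trans (hmono' _ hk'))) _) hd
      _ = t * q₃ (x - y) := by
          rw [← Finset.sum_mul, Finset.sum_range_sub, h0, hn, sub_zero]
  have e : ∑ k ∈ Finset.range n, ((s (k + 1) - s k : ℝ) : 𝕜) •
        T (t - (ξ k).toNNReal) (D (S (ξ k).toNNReal x)) - (S t - T t) x
      = ∑ k ∈ Finset.range n, ((s (k + 1) - s k : ℝ) : 𝕜) •
          T (t - (ξ k).toNNReal) (D (S (ξ k).toNNReal (x - y)))
        + (T t (x - y) + -S t (x - y))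
        + (∑ k ∈ Finset.range n, ((s (k + 1) - s k : ℝ) : 𝕜) •
          T (t - (ξ k).toNNReal) (D (S (ξ k).toNNReal y)) - (S t y - T t y)) := by
    simp only [map_sub, smul_sub, Finset.sum_sub_distrib, sub_apply]
    abel
  rw [e]
  refine ((map_add_le_add p _ _).trans (add_le_add_left (map_add_le_add p _ _) _)).trans_lt ?_
  have h2 : p (T t (x - y) + -S t (x - y)) ≤ p (T t (x - y)) + p (S t (x - y)) := by
    simpa only [map_neg_eq_map] using map_add_le_add p (T t (x - y)) (-S t (x - y))
  have h3 : t * q₃ (x - y) ≤ η * t := by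
    rw [mul_comm]
    exact mul_le_mul_of_nonneg_right hy₃.le ht0
  linarith [hT₀ t le_rfl (x - y), hS₁ t le_rfl (x - y)]

omit [ContinuousSMul 𝕜 E] [PolynormableSpace 𝕜 E] in
theorem HasStrongIntegral.neg {F : ℝ → E →L[𝕜] E} {a b : ℝ} {I : E →L[𝕜] E}
    (h : HasStrongIntegral F a b I) : HasStrongIntegral (fun τ => -F τ) a b (-I) := by
  intro x U hU
  have hU' : Neg.neg ⁻¹' U ∈ 𝓝 (I x) := (continuous_neg.tendsto (I x)) hU
  obtain ⟨δ, hδ, hs⟩ := h x _ hU'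
  refine ⟨δ, hδ, fun n s ξ h0 hn hp => ?_⟩
  have := hs n s ξ h0 hn hp
  simpa using this

end Integral

end Perturbation

open Perturbation in
theorem theorem1 {𝕜 E : Type*} [RCLike 𝕜] [AddCommGroup E] [Module 𝕜 E]
    [UniformSpace E] [IsUniformAddGroup E] [ContinuousSMul 𝕜 E] [PolynormableSpace 𝕜 E]
    [T2Space E] (hE : SeqComplete E)
    (A₀ A₁ : E →ₗ.[𝕜] E) (hA₀ : HilleYosidaCondition A₀) (hA₁ : HilleYosidaCondition A₁)
    (D : E →L[𝕜] E) (hdom : A₁.domain = A₀.domain)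
    (hD : ∀ (x : E) (h₀ : x ∈ A₀.domain) (h₁ : x ∈ A₁.domain),
      A₁ ⟨x, h₁⟩ - A₀ ⟨x, h₀⟩ = D x) :
    (∃! Ω₀ : ℝ≥0 → E →L[𝕜] E, Generates A₀ Ω₀) ∧
    (∃! Ω₁ : ℝ≥0 → E →L[𝕜] E, Generates A₁ Ω₁) ∧
    ∀ Ω₀ Ω₁ : ℝ≥0 → E →L[𝕜] E, Generates A₀ Ω₀ → Generates A₁ Ω₁ →
      ∀ t : ℝ≥0,
        (∃ J : E →L[𝕜] E,
          HasStrongIntegral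
            (fun τ : ℝ => (Ω₀ (t - τ.toNNReal)).comp (D.comp (Ω₁ τ.toNNReal))) 0 t J ∧
          Ω₁ t = Ω₀ t + J) ∧
        (∃ J : E →L[𝕜] E,
          HasStrongIntegral
            (fun τ : ℝ => (Ω₁ (t - τ.toNNReal)).comp (D.comp (Ω₀ τ.toNNReal))) 0 t J ∧
          Ω₁ t = Ω₀ t + J) := by
  obtain ⟨T₀, hT₀, hT₀e⟩ := hA₀.exists_generates hE
  obtain ⟨T₁, hT₁, hT₁e⟩ := hA₁.exists_generates hE
  have hu₀ : ∀ Ω, Generates A₀ Ω → Ω = T₀ := fun Ω hΩ => hT₀.unique hA₀.1 hT₀e hΩ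
  have hu₁ : ∀ Ω, Generates A₁ Ω → Ω = T₁ := fun Ω hΩ => hT₁.unique hA₁.1 hT₁e hΩ
  refine ⟨⟨T₀, hT₀, hu₀⟩, ⟨T₁, hT₁, hu₁⟩, fun Ω₀ Ω₁ hΩ₀ hΩ₁ t => ?_⟩
  -- Uniqueness transfers local equicontinuity to the given semigroups.
  obtain rfl := hu₀ Ω₀ hΩ₀
  obtain rfl := hu₁ Ω₁ hΩ₁
  refine ⟨⟨Ω₁ t - Ω₀ t, hT₀.hasStrongIntegral hA₁.1 hT₁ hT₀e hT₁e hdom hD t, by abel⟩,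
    ⟨Ω₁ t - Ω₀ t, ?_, by abel⟩⟩
  -- With the roles exchanged the perturbation is `A₀ - A₁ = -D`; negating the integral restores
  -- both signs.
  have h := (hT₁.hasStrongIntegral hA₀.1 hT₀ hT₁e hT₀e hdom.symm (D := -D)
    (fun x h₁ h₀ => by rw [neg_apply, ← hD x h₀ h₁, neg_sub]) t).neg
  simpa using h
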